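/- Notation. Vectors carry the Euclidean norm, matrices the Frobenius norm. Let $T=[a_{i-j}]_{1\le i,j\le n}$ ($n\ge 1$) be a complex Toeplitz matrix with first row $\mathbf t_{1:}$ and first column $\mathbf t_{:1}$. Let $Z_\delta$ be the $n\times n$ matrix with ones on the first subdiagonal, $\delta$ in the upper right corner and zeros elsewhere (for $n=1$, $Z_\delta=[\delta]$). A matrix $A$ is of Toeplitz type (with displacement rank at most $\alpha$) if $Z_1A-AZ_{-1}=\Omega\Gamma$ for some $n\times\alpha$ matrix $\Omega$ and $\alpha\times n$ matrix $\Gamma$; for $T$ itself this holds with $$\Omega=\begin{bmatrix}1&0&\cdots&0\\ a_0&a_{1-n}+a_1&\cdots&a_{-1}+a_{n-1}\end{bmatrix}^T,\qquad \Gamma=\begin{bmatrix}a_{n-1}-a_{-1}&\cdots&a_1-a_{1-n}&a_0\\0&\cdots&0&1\end{bmatrix}.$$ Let $F=\frac1{\sqrt n}[e^{2\pi i(k-1)(j-1)/n}]_{k,j}$, $D=\mathrm{diag}(1,e^{\pi i/n},\dots,e^{\pi i(n-1)/n})$, $t_k=e^{2\pi i(k-1)/n}$ and $s_k=e^{\pi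 i(2k-1)/n}$. Floating-point model. With machine epsilon $\epsilon>0$, every rounding and every arithmetic operation satisfies $fl(x)=x(1+\delta)$, respectively $fl(a\star b)=(a\star b)(1+\delta)$, with $|\delta|\le\epsilon$ (complex arithmetic, $\delta$ depending on the operation). The GKO-Toeplitz algorithm, without breakdown, in this arithmetic: (i) form $\Omega$, $\Gamma$ from $T$ (each entry rounded); (ii) convert them to Cauchy generators $\tilde\Phi\approx F\Omega$, $\tilde\Psi^*\approx FD\Gamma^*$, each product with $F$ being evaluated with rounded coefficients, either as a matrix-vector product with any order of summation, or as an unnormalized discrete Fourier transform (computed directly or by the Cooley-Tukey FFT with any nontrivial factorizations) followed by multiplication by $fl(1/\sqrt n)$; (iii) apply to $\tilde\Phi,\tilde\Psi$ and the rounded nodes $t_k$, $s_k$ the GKO-Cauchy elimination: at step $k$ compute the first column and row of the current Schur complement from $r_{ij}=\varphi_i\psi_j/(t_i-s_j)$, possibly after a row interchange, set $l_{jk}=r_{jk}/r_{kk}$, $u_{kj}=r_{kj}$, and update $\varphi_j\leftarrow\varphi_j-\varphi_kl_{jk}$, $\psi_j\leftarrow\psi_j-\psi_ku_{kj}/u_{kk}$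 for $j>k$. This yields computed triangular factors $\tilde L,\tilde U$ and the permutation matrix $P$ of the row interchanges, which may be chosen in any way ($P=I$ if there are none). Let $\tilde R=[(\tilde\Phi\tilde\Psi)_{ij}/(t_i-s_j)]$ be the exact Cauchy-type matrix with the computed generators (and exact nodes), and let $E=P^T\tilde L\tilde U-\tilde R$ be the backward error of the Cauchy factorization. Theorem. There is an absolute constant $c_{11}>0$ such that, for all $n\ge1$, all $\epsilon>0$ with $n\epsilon\le 1$, all $T$, and all computed results $\tilde\Phi,\tilde\Psi,P,\tilde L,\tilde U$ of the GKO-Toeplitz algorithm as above, $$F^*P^T\tilde L\tilde U FD = T+E^{(1)}+E^{(2)}$$ for some matrices with $\|E^{(1)}\|=\|E\|$ and $E^{(2)}$ of Toeplitz type with displacement rank at most $4$ and $$\|E^{(2)}\|\le \epsilon\,c_{11}\,n^2\left(\|\mathbf t_{1:}\|+\|\mathbf t_{:1}\|\right).$$ In particular, without row interchanges, $F^*\tilde L\tilde UFD=T+E^{(1)}+E^{(2)}$. -/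

import Mathlib

/- Vectors carry the Euclidean norm, matrices the Frobenius norm. -/
attribute [local instance] Matrix.frobeniusNormedAddCommGroup

namespace GKO

noncomputable section

/-! ### Structured matrices -/

/-- The Toeplitz matrix `[a_{i-j}]` of order `n`. -/
def toeplitz (n : ℕ) (a : ℤ → ℂ) : Matrix (Fin n) (Fin n) ℂ :=
  Matrix.of fun i j => a ((i : ℤ) - (j : ℤ))

/-- The matrix `Z_δ`: ones on the first subdiagonal, `δ` in the upper right corner. -/
def shiftZ (n : ℕ) (δ : ℂ) : Matrix (Fin n) (Fin n) ℂ :=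
  Matrix.of fun i j =>
    if (i : ℕ) = (j : ℕ) + 1 then 1 else if (i : ℕ) = 0 ∧ (j : ℕ) + 1 = n then δ else 0

/-- `A` is a Toeplitz-type matrix with a generator of length `α`:
`Z_1 A - A Z_{-1} = Ω Γ` with `Ω` of size `n × α` and `Γ` of size `α × n`. -/
def IsToeplitzType {n : ℕ} (α : ℕ) (A : Matrix (Fin n) (Fin n) ℂ) : Prop :=
  ∃ (Ω : Matrix (Fin n) (Fin α) ℂ) (Γ : Matrix (Fin α) (Fin n) ℂ),
    shiftZ n 1 * A - A * shiftZ n (-1) = Ω * Γ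

/-- The left generator of the Toeplitz matrix `[a_{i-j}]`: the columns are `e_1` and
`(a_0, a_{1-n} + a_1, …, a_{-1} + a_{n-1})`. -/
def toeplitzOmega (n : ℕ) (a : ℤ → ℂ) : Matrix (Fin n) (Fin 2) ℂ :=
  Matrix.of fun i => ![if (i : ℕ) = 0 then 1 else 0,
    if (i : ℕ) = 0 then a 0 else a ((i : ℤ) - (n : ℤ)) + a (i : ℤ)]

/-- The right generator of the Toeplitz matrix `[a_{i-j}]`: the rows are
`(a_{n-1} - a_{-1}, a_{n-2} - a_{-2}, …, a_1 - a_{1-n}, a_0)` and `e_n^T`. -/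
def toeplitzGamma (n : ℕ) (a : ℤ → ℂ) : Matrix (Fin 2) (Fin n) ℂ :=
  Matrix.of ![
    fun j => if (j : ℕ) + 1 = n then a 0
      else a ((n : ℤ) - 1 - (j : ℤ)) - a (-((j : ℤ) + 1)),
    fun j => if (j : ℕ) + 1 = n then 1 else 0]

/-- `e^{2 π i k / n}`. -/
def root (n k : ℕ) : ℂ := Complex.exp (2 * Real.pi * Complex.I * k / n)

/-- The unitary discrete Fourier transform matrix `F`. -/
def fourierF (n : ℕ) : Matrix (Fin n) (Fin n) ℂ :=
  Matrix.of fun k j => ((1 / Real.sqrt n : ℝ) : ℂ) * root n ((k : ℕ) * (j : ℕ))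

/-- The `j`-th diagonal entry `e^{π i j / n}` of `D` (counted from zero). -/
def diagEntry (n : ℕ) (j : Fin n) : ℂ := Complex.exp (Real.pi * Complex.I * (j : ℕ) / n)

/-- `D = diag(1, e^{π i / n}, …, e^{π i (n-1) / n})`. -/
def diagD (n : ℕ) : Matrix (Fin n) (Fin n) ℂ := Matrix.diagonal (diagEntry n)

/-- The nodes `1, e^{2 π i / n}, …, e^{2 π i (n-1) / n}`. -/
def nodeT (n : ℕ) (i : Fin n) : ℂ := root n (i : ℕ)

/-- The nodes `e^{π i / n}, e^{3 π i / n}, …, e^{(2n-1) π i / n}`. -/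
def nodeS (n : ℕ) (j : Fin n) : ℂ :=
  Complex.exp (Real.pi * Complex.I * (2 * (j : ℕ) + 1) / n)

/-- The Cauchy-type matrix `[φ_i ψ_j / (t_i - s_j)]` with generators `Φ`, `Ψ`. -/
def cauchyType {n α : ℕ} (t s : Fin n → ℂ) (Φ : Matrix (Fin n) (Fin α) ℂ)
    (Ψ : Matrix (Fin α) (Fin n) ℂ) : Matrix (Fin n) (Fin n) ℂ :=
  Matrix.of fun i j => (Φ * Ψ) i j / (t i - s j)

/-! ### Floating-point arithmetic

Computed quantities are described by relations: every rounding may commit its own relative error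
of modulus at most `ε` (which may be zero). -/

/-- `y` is a possible value of `fl(x)`: `y = x (1 + δ)` with `|δ| ≤ ε`.  The computed result of
an operation `a ⋆ b` is a `y` with `Rounds ε (a ⋆ b) y`. -/
def Rounds (ε : ℝ) (x y : ℂ) : Prop := ∃ δ : ℂ, ‖δ‖ ≤ ε ∧ y = x * (1 + δ)

/-- `FlSum ε f s y`: `y` is a possible computed value of `∑ i ∈ s, f i`, each `f i` being the
exact result of one operation; the additions may be carried out in any order. -/
inductive FlSum {ι : Type} [DecidableEq ι] (ε : ℝ) (f : ι → ℂ) : Finset ι → ℂ → Prop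
  | single (i : ι) (y : ℂ) : Rounds ε (f i) y → FlSum ε f {i} y
  | join (s₁ s₂ : Finset ι) (y₁ y₂ y : ℂ) : Disjoint s₁ s₂ → FlSum ε f s₁ y₁ →
      FlSum ε f s₂ y₂ → Rounds ε (y₁ + y₂) y → FlSum ε f (s₁ ∪ s₂) y

/-- `y` is a possible computed value of the inner product `∑ i, u i * v i`. -/
def FlDot {m : ℕ} (ε : ℝ) (u v : Fin m → ℂ) (y : ℂ) : Prop :=
  FlSum ε (fun i => u i * v i) Finset.univ y

theorem index_lt {p q : ℕ} (a : Fin p) (b : Fin q) : (a : ℕ) + p * (b : ℕ) < p * q := by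
  have h : p * ((b : ℕ) + 1) ≤ p * q := Nat.mul_le_mul_left p b.isLt
  have ha := a.isLt
  rw [Nat.mul_add, Nat.mul_one] at h
  omega

/-- `FlDFT ε n x y`: `y` is a possible computed value of the unnormalized discrete Fourier
transform `k ↦ ∑ j, e^{2 π i k j / n} x_j`, evaluated either directly, with rounded coefficients,
or by a fast Fourier transform step (Cooley and Tukey): for `n = p q`, transforms of length `q` of
the `p` subsequences `x_a, x_{a+p}, …`, multiplication by rounded twiddle factors, and transforms
of length `p`. -/
inductive FlDFT (ε : ℝ) : (n : ℕ) → (Fin n → ℂ) → (Fin n → ℂ) → Prop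
  | direct (n : ℕ) (x y : Fin n → ℂ) (w : Fin n → Fin n → ℂ) :
      (∀ k j : Fin n, Rounds ε (root n ((k : ℕ) * (j : ℕ))) (w k j)) →
      (∀ k, FlDot ε (w k) x (y k)) → FlDFT ε n x y
  | fast (p q : ℕ) (x y : Fin (p * q) → ℂ) (g w h : Fin p → Fin q → ℂ) :
      2 ≤ p → 2 ≤ q →
      (∀ a : Fin p, FlDFT ε q (fun b => x ⟨a + p * b, index_lt a b⟩) (g a)) →
      (∀ (a : Fin p) (c : Fin q), Rounds ε (root (p * q) ((a : ℕ) * (c : ℕ))) (w a c)) →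
      (∀ a c, Rounds ε (w a c * g a c) (h a c)) →
      (∀ c : Fin q, FlDFT ε p (fun a => h a c)
        (fun d => y ⟨c + q * d, (index_lt c d).trans_eq (Nat.mul_comm q p)⟩)) →
      FlDFT ε (p * q) x y

/-- `y` is a possible computed value of `F x`: either the matrix-vector product with the rounded
matrix `F`, or an unnormalized transform followed by a multiplication with the rounded factor
`1 / √n`. -/
def FlFourier (ε : ℝ) (n : ℕ) (x y : Fin n → ℂ) : Prop :=
  (∃ G : Matrix (Fin n) (Fin n) ℂ, (∀ k j, Rounds ε (fourierF n k j) (G k j)) ∧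
    ∀ k, FlDot ε (G k) x (y k)) ∨
  (∃ (z : Fin n → ℂ) (c : ℂ), FlDFT ε n x z ∧
    Rounds ε ((1 / Real.sqrt n : ℝ) : ℂ) c ∧ ∀ k, Rounds ε (c * z k) (y k))

/-! ### The algorithm -/

/-- The left Cauchy generator `Φ = F Ω`, computed from the rounded generator `Ω` of the Toeplitz
matrix `[a_{i-j}]`. -/
def FlPhi (ε : ℝ) (n : ℕ) (a : ℤ → ℂ) (Φ : Matrix (Fin n) (Fin 2) ℂ) : Prop :=
  ∃ Ω : Matrix (Fin n) (Fin 2) ℂ, (∀ i l, Rounds ε (toeplitzOmega n a i l) (Ω i l)) ∧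
    ∀ l, FlFourier ε n (fun i => Ω i l) (fun i => Φ i l)

/-- The right Cauchy generator `Ψ`, `Ψ* = F D Γ*`, computed from the rounded `D` and the rounded
generator `Γ` of the Toeplitz matrix `[a_{i-j}]`. -/
def FlPsi (ε : ℝ) (n : ℕ) (a : ℤ → ℂ) (Ψ : Matrix (Fin 2) (Fin n) ℂ) : Prop :=
  ∃ (Γ X : Matrix (Fin 2) (Fin n) ℂ) (d : Fin n → ℂ),
    (∀ l j, Rounds ε (toeplitzGamma n a l j) (Γ l j)) ∧
    (∀ j, Rounds ε (diagEntry n j) (d j)) ∧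
    (∀ l j, Rounds ε (d j * star (Γ l j)) (X l j)) ∧
    ∀ l, FlFourier ε n (fun j => X l j) (fun j => star (Ψ l j))

/-- `r` is a possible computed value of `φ_i ψ_j / (t_i - s_j)`. -/
def FlCauchyEntry {n α : ℕ} (ε : ℝ) (t s : Fin n → ℂ) (Φ : Matrix (Fin n) (Fin α) ℂ)
    (Ψ : Matrix (Fin α) (Fin n) ℂ) (i j : Fin n) (r : ℂ) : Prop :=
  ∃ num den : ℂ, FlDot ε (fun l => Φ i l) (fun l => Ψ l j) num ∧
    Rounds ε (t i - s j) den ∧ den ≠ 0 ∧ Rounds ε (num / den) r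

/-- `L` and `U` are possible computed triangular factors of a run of the GKO-Cauchy algorithm on
the nodes `t`, `s` and the generators `Φ`, `Ψ`, the rows being in pivotal order already.
Here `φ k`, `ψ k` are the computed generators before step `k` (counted from zero) and `r j k` is
the computed entry in row `j` of the first column of the `k`-th reduced matrix. -/
def FlGKOCauchy {n α : ℕ} (ε : ℝ) (t s : Fin n → ℂ) (Φ : Matrix (Fin n) (Fin α) ℂ)
    (Ψ : Matrix (Fin α) (Fin n) ℂ) (L U : Matrix (Fin n) (Fin n) ℂ) : Prop :=
  ∃ (φ : ℕ → Matrix (Fin n) (Fin α) ℂ) (ψ : ℕ → Matrix (Fin α) (Fin n) ℂ)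
    (r : Matrix (Fin n) (Fin n) ℂ),
    φ 0 = Φ ∧ ψ 0 = Ψ ∧
    -- recover the first column and the first row of the reduced matrix
    (∀ k j : Fin n, k ≤ j → FlCauchyEntry ε t s (φ k) (ψ k) j k (r j k)) ∧
    (∀ k j : Fin n, k < j → FlCauchyEntry ε t s (φ k) (ψ k) k j (U k j)) ∧
    -- column `k` of `L` and row `k` of `U`
    (∀ k : Fin n, U k k = r k k ∧ L k k = 1) ∧
    (∀ k j : Fin n, k < j → U k k ≠ 0 ∧ Rounds ε (r j k / r k k) (L j k)) ∧
    (∀ k j : Fin n, k < j → L k j = 0 ∧ U j k = 0) ∧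
    -- update the generators
    (∀ k j : Fin n, k < j → ∀ l : Fin α, ∃ x y : ℂ, Rounds ε (ψ k l k * U k j) x ∧
      Rounds ε (x / U k k) y ∧ Rounds ε (ψ k l j - y) (ψ (k + 1) l j)) ∧
    (∀ k j : Fin n, k < j → ∀ l : Fin α, ∃ x : ℂ, Rounds ε (φ k k l * L j k) x ∧
      Rounds ε (φ k j l - x) (φ (k + 1) j l))

/-- A floating-point run of the GKO-Toeplitz algorithm on the Toeplitz matrix `[a_{i-j}]` of order
`n`: `Φ`, `Ψ` are the computed Cauchy generators, and `L`, `U` are the factors computed from them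
by the GKO-Cauchy algorithm (with rounded nodes), `σ` being the product of the row interchanges:
row `i` of the pivoted matrix is row `σ i` of the original one.  The interchanges may be chosen in
any way; partial pivoting and no pivoting (`σ = 1`) are special cases. -/
def FlGKOToeplitz (ε : ℝ) (n : ℕ) (a : ℤ → ℂ) (Φ : Matrix (Fin n) (Fin 2) ℂ)
    (Ψ : Matrix (Fin 2) (Fin n) ℂ) (σ : Equiv.Perm (Fin n))
    (L U : Matrix (Fin n) (Fin n) ℂ) : Prop :=
  FlPhi ε n a Φ ∧ FlPsi ε n a Ψ ∧
  ∃ t s : Fin n → ℂ, (∀ i, Rounds ε (nodeT n i) (t i)) ∧ (∀ j, Rounds ε (nodeS n j) (s j)) ∧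
    FlGKOCauchy ε (t ∘ σ) s (Φ.submatrix σ id) Ψ L U

/-- The permutation matrix `P` of the row interchanges: row `i` of `P A` is row `σ i` of `A`. -/
def permP {n : ℕ} (σ : Equiv.Perm (Fin n)) : Matrix (Fin n) (Fin n) ℂ :=
  Matrix.of fun i j => if σ i = j then 1 else 0

/-- The backward error `E = Pᵀ L U - R` of the Cauchy factorization, where `R` is the exact
Cauchy-type matrix generated by the computed generators `Φ`, `Ψ`. -/
def cauchyBackwardError {n : ℕ} (Φ : Matrix (Fin n) (Fin 2) ℂ) (Ψ : Matrix (Fin 2) (Fin n) ℂ)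
    (σ : Equiv.Perm (Fin n)) (L U : Matrix (Fin n) (Fin n) ℂ) : Matrix (Fin n) (Fin n) ℂ :=
  (permP σ).transpose * L * U - cauchyType (nodeT n) (nodeS n) Φ Ψ

/-- The Euclidean norm of a vector. -/
def vecNorm {n : ℕ} (v : Fin n → ℂ) : ℝ := ‖WithLp.toLp 2 v‖

end

end GKO

namespace GKO

/-! Put `W = F D`. With `R` the Cauchy-type matrix of the computed generators, take `E₁ = Fᴴ E W`
and `E₂ = Fᴴ R W - T`. The identity is then immediate, and unitarity of `F` and `W` gives `‖E₁‖ =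
‖E‖`: the elimination error stays wholly in `E`, so only the conversion to Cauchy generators has to
be analysed.

`F` diagonalizes `Z_1` and `W` diagonalizes `Z_{-1}`, with the nodes as eigenvalues. Hence `F T Wᴴ`
is the Cauchy-type matrix `R'` of the exact generators (`fourierF_mul_toeplitz_mul`), and `Fᴴ R W`
has a displacement generator of length 2. Subtracting `T` gives length 4, and `‖E₂‖ = ‖R - R'‖`.

Each computed generator entry is the exact sum with its terms multiplied by factors within `u = (1 +
ε)^(9n) - 1 = O(nε)` of 1 (`FlFourier.exists_nearOne`). Entries of `F` and `W` have modulus `1/√n`,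
so errors are governed by `ℓ¹` norms of the Toeplitz generators. In each of the two rank-one terms
one generator is a unit vector, so the product of generators is off by `O(u S / n)` entrywise, `S`
being the `ℓ¹` size of the first row and column. The matrix `[1/(t_i - s_j)]` has norm exactly
`n√n/2` (`norm_cauchyNodes`), and `S` is at most `√n` times the Euclidean norms, which yields `ε
n²`. -/

/-! ### Accumulated rounding errors -/

/-- `z` is within the error bound of a product of `m` factors `1 + δ` with `|δ| ≤ ε`. -/
def NearOne (ε : ℝ) (m : ℕ) (z : ℂ) : Prop := ‖z - 1‖ ≤ (1 + ε) ^ m - 1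

theorem NearOne.mono {ε : ℝ} (hε : 0 ≤ ε) {m m' : ℕ} {z : ℂ} (hm : m ≤ m')
    (h : NearOne ε m z) : NearOne ε m' z := by
  have h2 : (1 + ε) ^ m ≤ (1 + ε) ^ m' := pow_le_pow_right₀ (by linarith) hm
  unfold NearOne at *
  linarith

/-- Expanding `z z' - 1` in `z - 1` and `z' - 1` reproduces the expansion of `(1 + ε)^(m + m') - 1`,
so rounding counts simply add. -/
theorem NearOne.mul {ε : ℝ} {m m' : ℕ} {z z' : ℂ} (h : NearOne ε m z)
    (h' : NearOne ε m' z') : NearOne ε (m + m') (z * z') := by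
  unfold NearOne at *
  have e : z * z' - 1 = (z - 1) * (z' - 1) + (z - 1) + (z' - 1) := by ring
  have h1 : ‖(z - 1) * (z' - 1)‖ ≤ ((1 + ε) ^ m - 1) * ((1 + ε) ^ m' - 1) := by
    rw [norm_mul]
    exact mul_le_mul h h' (norm_nonneg _) ((norm_nonneg _).trans h)
  calc ‖z * z' - 1‖ ≤ ‖(z - 1) * (z' - 1)‖ + ‖z - 1‖ + ‖z' - 1‖ := by rw [e]; exact norm_add₃_le
    _ ≤ ((1 + ε) ^ m - 1) * ((1 + ε) ^ m' - 1) + ((1 + ε) ^ m - 1) + ((1 + ε) ^ m' - 1) := by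
      linarith
    _ = (1 + ε) ^ (m + m') - 1 := by rw [pow_add]; ring

theorem NearOne.star {ε : ℝ} {m : ℕ} {z : ℂ} (h : NearOne ε m z) : NearOne ε m (star z) := by
  unfold NearOne at *
  rwa [show Star.star z - 1 = Star.star (z - 1) by simp, norm_star]

theorem Rounds.exists_nearOne {ε : ℝ} {x y : ℂ} (h : Rounds ε x y) :
    ∃ z, NearOne ε 1 z ∧ y = x * z := by
  obtain ⟨δ, hδ, rfl⟩ := h
  exact ⟨1 + δ, by simpa [NearOne] using hδ, rfl⟩

theorem FlSum.nonempty {ι : Type} [DecidableEq ι] {ε : ℝ} {f : ι → ℂ} {s : Finset ι} {y : ℂ}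
    (h : FlSum ε f s y) : s.Nonempty := by
  induction h with
  | single i y _ => exact Finset.singleton_nonempty i
  | join s₁ s₂ y₁ y₂ y _ _ _ _ h₁ _ => exact h₁.mono Finset.subset_union_left

/-- A summation tree with `m` leaves has depth at most `m - 1`; the rounding of the summand itself
makes `m`. -/
theorem FlSum.exists_nearOne {ι : Type} [DecidableEq ι] {ε : ℝ} (hε : 0 ≤ ε) {f : ι → ℂ}
    {s : Finset ι} {y : ℂ} (h : FlSum ε f s y) :
    ∃ z : ι → ℂ, (∀ i ∈ s, NearOne ε s.card (z i)) ∧ y = ∑ i ∈ s, f i * z i := by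
  induction h with
  | single i y h =>
    obtain ⟨z, hz, rfl⟩ := h.exists_nearOne
    exact ⟨fun _ => z, by simpa using hz, by simp⟩
  | join s₁ s₂ y₁ y₂ y hd h₁ h₂ hr ih₁ ih₂ =>
    obtain ⟨z₁, hz₁, rfl⟩ := ih₁
    obtain ⟨z₂, hz₂, rfl⟩ := ih₂
    obtain ⟨z, hz, rfl⟩ := hr.exists_nearOne
    -- Both halves are nonempty, so the other half's cardinality pays for the rounding of this
    -- addition.
    have c₁ := h₁.nonempty.card_pos
    have c₂ := h₂.nonempty.card_pos
    refine ⟨fun i => if i ∈ s₁ then z₁ i * z else z₂ i * z, fun i hi => ?_, ?_⟩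
    · rw [Finset.card_union_of_disjoint hd]
      by_cases h : i ∈ s₁
      · simp only [h, if_true]
        exact ((hz₁ i h).mul hz).mono hε (by omega)
      · simp only [h, if_false]
        have h' : i ∈ s₂ := by simpa [h] using hi
        exact ((hz₂ i h').mul hz).mono hε (by omega)
    · rw [Finset.sum_union hd, add_mul, Finset.sum_mul, Finset.sum_mul]
      congr 1
      · refine Finset.sum_congr rfl fun i hi => ?_
        simp [hi, mul_assoc]
      · refine Finset.sum_congr rfl fun i hi => ?_
        simp [Finset.disjoint_right.1 hd hi, mul_assoc]

theorem FlDot.exists_nearOne {m : ℕ} {ε : ℝ} (hε : 0 ≤ ε) {u v : Fin m → ℂ} {y : ℂ}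
    (h : FlDot ε u v y) :
    ∃ z : Fin m → ℂ, (∀ i, NearOne ε m (z i)) ∧ y = ∑ i, u i * v i * z i := by
  obtain ⟨z, hz, rfl⟩ := FlSum.exists_nearOne hε h
  exact ⟨z, fun i => by simpa using hz i (Finset.mem_univ i), rfl⟩

/-- A product with rounded coefficients. -/
theorem FlDot.exists_nearOne_of_rounds {m : ℕ} {ε : ℝ} (hε : 0 ≤ ε) {u u' v : Fin m → ℂ} {y : ℂ}
    (hu : ∀ j, Rounds ε (u j) (u' j)) (h : FlDot ε u' v y) :
    ∃ z : Fin m → ℂ, (∀ i, NearOne ε (m + 1) (z i)) ∧ y = ∑ i, u i * v i * z i := by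
  obtain ⟨z, hz, rfl⟩ := h.exists_nearOne hε
  choose w hw hw' using fun j => (hu j).exists_nearOne
  refine ⟨fun i => z i * w i, fun i => (hz i).mul (hw i), Finset.sum_congr rfl fun i _ => ?_⟩
  rw [hw']; ring

/-! ### Roots of unity -/

theorem root_add (n a b : ℕ) : root n (a + b) = root n a * root n b := by
  unfold root
  rw [← Complex.exp_add]
  push_cast
  ring_nf

theorem root_eq_pow (n k : ℕ) : root n k = root n 1 ^ k := by
  unfold root
  rw [← Complex.exp_nat_mul]
  push_cast
  ring_nf

theorem root_mul_left {p q : ℕ} (hp : p ≠ 0) (m : ℕ) : root (p * q) (p * m) = root q m := by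
  unfold root
  have hp' : (p : ℂ) ≠ 0 := by exact_mod_cast hp
  congr 1
  push_cast
  rcases eq_or_ne (q : ℂ) 0 with hq | hq
  · simp [hq]
  · field_simp

theorem isPrimitiveRoot_root {n : ℕ} (hn : n ≠ 0) : IsPrimitiveRoot (root n 1) n := by
  have h := Complex.isPrimitiveRoot_exp n hn
  simpa [root] using h

theorem root_self_mul {n : ℕ} (hn : n ≠ 0) (m : ℕ) : root n (n * m) = 1 := by
  rw [root_eq_pow, pow_mul, (isPrimitiveRoot_root hn).pow_eq_one, one_pow]

theorem norm_root (n k : ℕ) : ‖root n k‖ = 1 := by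
  unfold root
  rw [show (2 * Real.pi * Complex.I * k / n : ℂ) = ((2 * Real.pi * k / n : ℝ) : ℂ) * Complex.I by
    push_cast; ring]
  exact Complex.norm_exp_ofReal_mul_I _

/-! ### Rounding errors of discrete Fourier transforms -/

/-- The Cooley-Tukey numbering of `Fin (p * q)`. -/
def cooleyTukeyEquiv (p q : ℕ) : Fin p × Fin q ≃ Fin (p * q) :=
  (Equiv.prodComm _ _).trans (finProdFinEquiv.trans (finCongr (Nat.mul_comm q p)))

theorem root_cooleyTukey {p q : ℕ} (hp : p ≠ 0) (hq : q ≠ 0) (a b c d : ℕ) :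
    root (p * q) ((c + q * d) * (a + p * b)) =
      root p (d * a) * root (p * q) (a * c) * root q (c * b) := by
  rw [show (c + q * d) * (a + p * b) = q * (d * a) + a * c + p * (c * b) + (p * q) * (d * b) by
    ring, root_add, root_add, root_add, root_self_mul (mul_ne_zero hp hq), mul_one,
    root_mul_left hp]
  congr 2
  rw [mul_comm p q, root_mul_left hq]

/-- The exponent `4n - 2` is chosen to survive the fast step, which adds two roundings (twiddle
factor and product): `(4p - 2) + (4q - 2) + 2 ≤ 4pq - 2`, because `p + q ≤ pq` for `p, q ≥ 2`. The
direct case needs only `n + 1`. -/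
theorem FlDFT.exists_nearOne {ε : ℝ} (hε : 0 ≤ ε) {n : ℕ} {x y : Fin n → ℂ}
    (h : FlDFT ε n x y) :
    ∃ Z : Fin n → Fin n → ℂ, (∀ k j, NearOne ε (4 * n - 2) (Z k j)) ∧
      ∀ k : Fin n, y k = ∑ j : Fin n, root n ((k : ℕ) * (j : ℕ)) * x j * Z k j := by
  induction h with
  | direct n x y w hw hy =>
    choose Z hZ hZ' using fun k => (hy k).exists_nearOne_of_rounds hε (hw k)
    refine ⟨Z, fun k j => (hZ k j).mono hε ?_, hZ'⟩
    have := k.isLt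
    omega
  | fast p q x y g w h hp hq _ hw hh _ ihg ihy =>
    choose Zg hZg hg using ihg
    choose Zy hZy hy using ihy
    choose zw hzw hw using fun a c => (hw a c).exists_nearOne
    choose zh hzh hh using fun a c => (hh a c).exists_nearOne
    beta_reduce at hg hy
    -- Inputs are numbered as `a + p b` and outputs as `c + q d`, hence two different equivalences.
    let e := cooleyTukeyEquiv p q
    let e' : Fin q × Fin p ≃ Fin (p * q) :=
      (cooleyTukeyEquiv q p).trans (finCongr (Nat.mul_comm q p))
    refine ⟨fun k j => Zg (e.symm j).1 (e'.symm k).1 (e.symm j).2 *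
      zw (e.symm j).1 (e'.symm k).1 * zh (e.symm j).1 (e'.symm k).1 *
      Zy (e'.symm k).1 (e'.symm k).2 (e.symm j).1, fun k j => ?_, fun k => ?_⟩
    · refine ((((hZg _ _ _).mul (hzw _ _)).mul (hzh _ _)).mul (hZy _ _ _)).mono hε ?_
      have : p + q ≤ p * q := by nlinarith
      omega
    · obtain ⟨⟨c, d⟩, rfl⟩ := e'.surjective k
      have e1 : e' (c, d) = ⟨c + q * d, (index_lt c d).trans_eq (Nat.mul_comm q p)⟩ := rfl
      rw [← e.sum_comp, Fintype.sum_prod_type]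
      simp only [Equiv.symm_apply_apply]
      rw [e1, hy c d]
      refine Finset.sum_congr rfl fun a _ => ?_
      rw [hh, hw, hg, Finset.mul_sum, Finset.sum_mul, Finset.mul_sum, Finset.sum_mul]
      refine Finset.sum_congr rfl fun b _ => ?_
      have e2 : e (a, b) = ⟨a + p * b, index_lt a b⟩ := rfl
      rw [e2]
      simp only
      rw [root_cooleyTukey (by omega) (by omega)]
      ring

theorem FlFourier.exists_nearOne {ε : ℝ} (hε : 0 ≤ ε) {n : ℕ} {x y : Fin n → ℂ}
    (h : FlFourier ε n x y) :
    ∃ Z : Fin n → Fin n → ℂ, (∀ k j, NearOne ε (4 * n) (Z k j)) ∧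
      ∀ k, y k = ∑ j, fourierF n k j * x j * Z k j := by
  rcases h with ⟨G, hG, hy⟩ | ⟨z, c, hz, hc, hy⟩
  · choose Z hZ hZ' using fun k => (hy k).exists_nearOne_of_rounds hε (hG k)
    refine ⟨Z, fun k j => (hZ k j).mono hε ?_, hZ'⟩
    have := k.isLt
    omega
  · obtain ⟨Z, hZ, hZ'⟩ := hz.exists_nearOne hε
    obtain ⟨w, hw, rfl⟩ := hc.exists_nearOne
    choose v hv hv' using fun k => (hy k).exists_nearOne
    refine ⟨fun k j => Z k j * w * v k, fun k j => (((hZ k j).mul hw).mul (hv k)).mono hε ?_,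
      fun k => ?_⟩
    -- The rounded `1/√n` and the final product add two roundings to `4n - 2`; the index `k` ensures
    -- `n ≥ 1`, so the truncated subtraction is harmless.
    · have := k.isLt
      omega
    · rw [hv', hZ', Finset.mul_sum, Finset.sum_mul]
      refine Finset.sum_congr rfl fun j _ => ?_
      simp only [fourierF, Matrix.of_apply]
      ring

open Matrix

/-! ### The Frobenius norm -/

theorem frobenius_norm_sq {m n : Type*} [Fintype m] [Fintype n] (A : Matrix m n ℂ) :
    ‖A‖ ^ 2 = ∑ i, ∑ j, ‖A i j‖ ^ 2 := by
  rw [frobenius_norm_def, ← Real.sqrt_eq_rpow, Real.sq_sqrt]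
  · simp
  · positivity

theorem frobenius_norm_sq_eq_trace {m n : Type*} [Fintype m] [Fintype n] (A : Matrix m n ℂ) :
    ((‖A‖ ^ 2 : ℝ) : ℂ) = (Aᴴ * A).trace := by
  rw [frobenius_norm_sq, Finset.sum_comm]
  simp only [trace, diag_apply, mul_apply, conjTranspose_apply]
  push_cast
  refine Finset.sum_congr rfl fun j _ => Finset.sum_congr rfl fun i _ => ?_
  exact (Complex.conj_mul' (A i j)).symm

theorem frobenius_norm_unitary_mul {n : Type*} [Fintype n] [DecidableEq n] {V : Matrix n n ℂ}
    (hV : Vᴴ * V = 1) (A : Matrix n n ℂ) : ‖V * A‖ = ‖A‖ := by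
  have h : ((‖V * A‖ ^ 2 : ℝ) : ℂ) = ((‖A‖ ^ 2 : ℝ) : ℂ) := by
    rw [frobenius_norm_sq_eq_trace, frobenius_norm_sq_eq_trace, conjTranspose_mul,
      Matrix.mul_assoc, ← Matrix.mul_assoc Vᴴ, hV, Matrix.one_mul]
  exact (sq_eq_sq₀ (norm_nonneg _) (norm_nonneg _)).1 (Complex.ofReal_injective h)

theorem frobenius_norm_mul_unitary {n : Type*} [Fintype n] [DecidableEq n] {V : Matrix n n ℂ}
    (hV : V * Vᴴ = 1) (A : Matrix n n ℂ) : ‖A * V‖ = ‖A‖ := by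
  rw [← frobenius_norm_conjTranspose, conjTranspose_mul, frobenius_norm_unitary_mul (by simpa),
    frobenius_norm_conjTranspose]

theorem frobenius_norm_le_of_entries {m n : Type*} [Fintype m] [Fintype n]
    {A C : Matrix m n ℂ} {b : ℝ} (hb : 0 ≤ b) (h : ∀ i j, ‖A i j‖ ≤ b * ‖C i j‖) :
    ‖A‖ ≤ b * ‖C‖ := by
  refine le_of_sq_le_sq ?_ (by positivity)
  rw [mul_pow, frobenius_norm_sq, frobenius_norm_sq, Finset.mul_sum]
  refine Finset.sum_le_sum fun i _ => ?_
  rw [Finset.mul_sum]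
  refine Finset.sum_le_sum fun j _ => ?_
  rw [← mul_pow]
  exact pow_le_pow_left₀ (norm_nonneg _) (h i j) 2

/-! ### The Fourier matrix -/

/-- Off the diagonal the entry is a geometric sum whose ratio is an `n`-th root of unity other than
1. -/
theorem fourierF_mul_conjTranspose {n : ℕ} (hn : n ≠ 0) : fourierF n * (fourierF n)ᴴ = 1 := by
  have hprim := isPrimitiveRoot_root hn
  have hn' : (n : ℂ) ≠ 0 := by exact_mod_cast hn
  have hs : ((1 / Real.sqrt n : ℝ) : ℂ) * ((1 / Real.sqrt n : ℝ) : ℂ) = 1 / n := by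
    rw [← Complex.ofReal_mul, ← sq, div_pow, Real.sq_sqrt (Nat.cast_nonneg n)]
    push_cast
    ring
  have hu (k : ℕ) : root n k * star (root n k) = 1 := by
    simp [Complex.mul_conj', norm_root]
  ext k l
  have hsum : (fourierF n * (fourierF n)ᴴ) k l =
      1 / n * ∑ j ∈ Finset.range n, (root n k * star (root n l)) ^ j := by
    rw [mul_apply, ← hs, Finset.mul_sum, ← Fin.sum_univ_eq_sum_range
      (fun j => ((1 / Real.sqrt n : ℝ) : ℂ) * ((1 / Real.sqrt n : ℝ) : ℂ) *
        (root n k * star (root n l)) ^ j)]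
    refine Finset.sum_congr rfl fun j _ => ?_
    have e (k : ℕ) : root n (k * j) = root n k ^ (j : ℕ) := by
      rw [root_eq_pow, pow_mul, ← root_eq_pow]
    simp only [fourierF, conjTranspose_apply, of_apply, star_mul', e, star_pow, mul_pow,
      Complex.star_def, Complex.conj_ofReal]
    ring
  rw [hsum]
  rcases eq_or_ne k l with rfl | hkl
  · simp only [hu, one_pow, Finset.sum_const, Finset.card_range, one_apply_eq]
    simp [hn']
  · rw [one_apply_ne hkl]
    have hz : root n k * star (root n l) ≠ 1 := fun h => by
      refine hkl (Fin.ext (hprim.pow_inj k.2 l.2 ?_))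
      rw [← root_eq_pow, ← root_eq_pow]
      calc root n k = root n k * (root n l * star (root n l)) := by rw [hu, mul_one]
        _ = root n k * star (root n l) * root n l := by ring
        _ = root n l := by rw [h, one_mul]
    have hzn : (root n k * star (root n l)) ^ n = 1 := by
      have e (k : ℕ) : root n k ^ n = 1 := by
        rw [root_eq_pow, ← pow_mul, mul_comm, pow_mul, hprim.pow_eq_one, one_pow]
      rw [mul_pow, ← star_pow, e, e]
      simp
    have hg := mul_geom_sum (root n k * star (root n l)) n
    rw [hzn, sub_self] at hg
    rw [(mul_eq_zero.1 hg).resolve_left (sub_ne_zero.2 hz), mul_zero]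

theorem fourierF_conjTranspose_mul {n : ℕ} (hn : n ≠ 0) : (fourierF n)ᴴ * fourierF n = 1 :=
  mul_eq_one_comm.1 (fourierF_mul_conjTranspose hn)

theorem norm_diagEntry (n : ℕ) (j : Fin n) : ‖diagEntry n j‖ = 1 := by
  unfold diagEntry
  rw [show (Real.pi * Complex.I * (j : ℕ) / n : ℂ) = ((Real.pi * (j : ℕ) / n : ℝ) : ℂ) * Complex.I by
    push_cast; ring]
  exact Complex.norm_exp_ofReal_mul_I _

theorem diagD_mul_conjTranspose (n : ℕ) : diagD n * (diagD n)ᴴ = 1 := by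
  rw [diagD, diagonal_conjTranspose, diagonal_mul_diagonal, ← diagonal_one]
  congr 1
  ext j
  simp [Complex.mul_conj', norm_diagEntry]

theorem fourierF_mul_diagD_mul_conjTranspose {n : ℕ} (hn : n ≠ 0) :
    (fourierF n * diagD n) * (fourierF n * diagD n)ᴴ = 1 := by
  rw [conjTranspose_mul, Matrix.mul_assoc, ← Matrix.mul_assoc (diagD n), diagD_mul_conjTranspose,
    Matrix.one_mul, fourierF_mul_conjTranspose hn]

theorem norm_fourierF (n : ℕ) (k j : Fin n) : ‖fourierF n k j‖ = 1 / Real.sqrt n := by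
  simp [fourierF, norm_root]

/-! ### The nodes -/

theorem nodeT_pow {n : ℕ} (hn : n ≠ 0) (i : Fin n) : nodeT n i ^ n = 1 := by
  rw [nodeT, root_eq_pow, ← pow_mul, mul_comm, pow_mul, (isPrimitiveRoot_root hn).pow_eq_one,
    one_pow]

theorem exp_half_pow {n : ℕ} (hn : n ≠ 0) : Complex.exp (Real.pi * Complex.I / n) ^ n = -1 := by
  have hn' : (n : ℂ) ≠ 0 := by exact_mod_cast hn
  rw [← Complex.exp_nat_mul, mul_div_cancel₀ _ hn', Complex.exp_pi_mul_I]

theorem nodeS_eq_pow (n : ℕ) (j : Fin n) :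
    nodeS n j = Complex.exp (Real.pi * Complex.I / n) ^ (2 * (j : ℕ) + 1) := by
  rw [← Complex.exp_nat_mul, nodeS]
  push_cast
  ring_nf

theorem diagEntry_eq_pow (n : ℕ) (j : Fin n) :
    diagEntry n j = Complex.exp (Real.pi * Complex.I / n) ^ (j : ℕ) := by
  rw [← Complex.exp_nat_mul, diagEntry]
  ring_nf

theorem root_eq_exp_half_pow (n k : ℕ) :
    root n k = Complex.exp (Real.pi * Complex.I / n) ^ (2 * k) := by
  rw [← Complex.exp_nat_mul, root]
  push_cast
  ring_nf

theorem nodeS_pow {n : ℕ} (hn : n ≠ 0) (j : Fin n) : nodeS n j ^ n = -1 := by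
  rw [nodeS_eq_pow, ← pow_mul, mul_comm _ n, pow_mul, exp_half_pow hn]
  exact Odd.neg_one_pow ⟨j, rfl⟩

theorem nodeT_ne_nodeS {n : ℕ} (hn : n ≠ 0) (i j : Fin n) : nodeT n i ≠ nodeS n j := fun h => by
  have h1 := nodeT_pow hn i
  rw [h, nodeS_pow hn] at h1
  norm_num at h1

theorem norm_nodeS (n : ℕ) (j : Fin n) : ‖nodeS n j‖ = 1 := by
  unfold nodeS
  rw [show (Real.pi * Complex.I * (2 * (j : ℕ) + 1) / n : ℂ) =
    ((Real.pi * (2 * (j : ℕ) + 1) / n : ℝ) : ℂ) * Complex.I by push_cast; ring]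
  exact Complex.norm_exp_ofReal_mul_I _

/-- The Cauchy matrix `[1 / (t_i - s_j)]`. -/
noncomputable def cauchyNodes (n : ℕ) : Matrix (Fin n) (Fin n) ℂ :=
  Matrix.of fun i j => 1 / (nodeT n i - nodeS n j)

/-- Since `t^n - s^n = 1 - (-1) = 2`, the quotient `2/(t - s)` is the polynomial `∑ t^m s^(n-1-m)`,
and the powers of the `t_i` form `√n F`. -/
theorem cauchyNodes_eq {n : ℕ} (hn : n ≠ 0) : cauchyNodes n =
    ((Real.sqrt n / 2 : ℝ) : ℂ) •
      (fourierF n * Matrix.of fun m j : Fin n => nodeS n j ^ (n - 1 - (m : ℕ))) := by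
  ext i j
  have hne := sub_ne_zero.2 (nodeT_ne_nodeS hn i j)
  have hs : (Real.sqrt n : ℂ) ≠ 0 := by
    rw [Complex.ofReal_ne_zero, Real.sqrt_ne_zero']
    exact_mod_cast Nat.pos_of_ne_zero hn
  have h := geom_sum₂_mul (nodeT n i) (nodeS n j) n
  rw [nodeT_pow hn, nodeS_pow hn, ← Fin.sum_univ_eq_sum_range
    (fun m => nodeT n i ^ m * nodeS n j ^ (n - 1 - m))] at h
  have h2 : (fourierF n * Matrix.of fun m j : Fin n => nodeS n j ^ (n - 1 - (m : ℕ))) i j =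
      1 / (Real.sqrt n : ℂ) * ∑ m : Fin n, nodeT n i ^ (m : ℕ) * nodeS n j ^ (n - 1 - (m : ℕ)) := by
    rw [mul_apply, Finset.mul_sum]
    refine Finset.sum_congr rfl fun m _ => ?_
    simp only [fourierF, of_apply, nodeT]
    rw [root_eq_pow, pow_mul, ← root_eq_pow]
    push_cast
    ring
  rw [Matrix.smul_apply, h2, cauchyNodes, of_apply, div_eq_iff hne, smul_eq_mul]
  push_cast
  field_simp
  linear_combination -h

/-- Up to a scalar and a unitary factor this is a matrix of unimodular entries, of norm `n`.
Bounding every entry by the largest, which is of order `n`, would lose a factor `√n`. -/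
theorem norm_cauchyNodes {n : ℕ} (hn : n ≠ 0) : ‖cauchyNodes n‖ = Real.sqrt n / 2 * n := by
  have hV : ‖(Matrix.of fun m j : Fin n => nodeS n j ^ (n - 1 - (m : ℕ)) : Matrix _ _ ℂ)‖ = n := by
    refine (sq_eq_sq₀ (norm_nonneg _) (Nat.cast_nonneg n)).1 ?_
    rw [frobenius_norm_sq]
    simp [norm_nodeS, sq]
  have hsm (c : ℂ) (A : Matrix (Fin n) (Fin n) ℂ) : ‖c • A‖ = ‖c‖ * ‖A‖ := by
    refine (sq_eq_sq₀ (norm_nonneg _) (by positivity)).1 ?_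
    rw [mul_pow, frobenius_norm_sq, frobenius_norm_sq, Finset.mul_sum]
    simp [mul_pow, Finset.mul_sum]
  rw [cauchyNodes_eq hn, hsm, frobenius_norm_unitary_mul (fourierF_conjTranspose_mul hn), hV,
    Complex.norm_real, Real.norm_of_nonneg (by positivity)]

/-! ### Displacement equations -/

theorem mul_shiftZ_apply {n : ℕ} {m : Type*} (A : Matrix m (Fin n) ℂ) (δ : ℂ) (i : m) (j : Fin n) :
    (A * shiftZ n δ) i j =
      if h : (j : ℕ) + 1 < n then A i ⟨j + 1, h⟩ else A i ⟨0, j.pos⟩ * δ := by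
  rw [mul_apply]
  split_ifs with h
  · rw [Finset.sum_eq_single ⟨j + 1, h⟩]
    · simp [shiftZ]
    · intro b _ hb
      have h1 : (b : ℕ) ≠ j + 1 := fun e => hb (Fin.ext e)
      have h2 : (j : ℕ) + 1 ≠ n := h.ne
      simp [shiftZ, h1, h2]
    · simp
  · have hj : (j : ℕ) + 1 = n := by have := j.isLt; omega
    rw [Finset.sum_eq_single ⟨0, j.pos⟩]
    · simp [shiftZ, hj, mt Eq.symm (Nat.ne_zero_of_lt j.isLt)]
    · intro b _ hb
      have h1 : (b : ℕ) ≠ 0 := fun e => hb (Fin.ext e)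
      have h2 : (b : ℕ) ≠ n := b.isLt.ne
      simp [shiftZ, h1, hj, h2]
    · simp

theorem shiftZ_mul_apply {n : ℕ} {m : Type*} (A : Matrix (Fin n) m ℂ) (δ : ℂ) (i : Fin n) (j : m) :
    (shiftZ n δ * A) i j =
      if (i : ℕ) = 0 then δ * A ⟨n - 1, Nat.sub_one_lt i.pos.ne'⟩ j
      else A ⟨i - 1, (Nat.sub_le _ _).trans_lt i.isLt⟩ j := by
  rw [mul_apply]
  have hi := i.isLt
  split_ifs with h
  · rw [Finset.sum_eq_single ⟨n - 1, Nat.sub_one_lt i.pos.ne'⟩]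
    · have h2 : n - 1 + 1 = n := by omega
      simp [shiftZ, h, h2, mt Eq.symm (Nat.ne_zero_of_lt hi)]
    · intro b _ hb
      have h1 : (b : ℕ) + 1 ≠ n := fun e => hb (Fin.ext (by simp; omega))
      simp [shiftZ, h, h1]
    · simp
  · rw [Finset.sum_eq_single ⟨i - 1, (Nat.sub_le _ _).trans_lt hi⟩]
    · have h2 : (i : ℕ) = i - 1 + 1 := by omega
      simp [shiftZ, ← h2]
    · intro b _ hb
      have h1 : (i : ℕ) ≠ b + 1 := fun e => hb (Fin.ext (by simp; omega))
      simp [shiftZ, h, h1]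
    · simp

/-- Row `k` of `F` is a geometric progression of ratio `t_k`; the wrap-around closes up because
`t_k^n = 1`. -/
theorem fourierF_mul_shiftZ {n : ℕ} (hn : n ≠ 0) :
    fourierF n * shiftZ n 1 = diagonal (nodeT n) * fourierF n := by
  ext k j
  rw [mul_shiftZ_apply, diagonal_mul]
  simp only [fourierF, nodeT, of_apply]
  rw [mul_left_comm, ← root_add, ← mul_one_add, add_comm 1]
  split_ifs with h
  · rfl
  · have hj : (j : ℕ) + 1 = n := by have := j.isLt; omega
    rw [hj, mul_comm (k : ℕ) n, root_self_mul hn]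
    simp [root]

theorem shiftZ_mul_conjTranspose_fourierF {n : ℕ} (hn : n ≠ 0) :
    shiftZ n 1 * (fourierF n)ᴴ = (fourierF n)ᴴ * diagonal (nodeT n) := by
  calc shiftZ n 1 * (fourierF n)ᴴ
      = (fourierF n)ᴴ * (fourierF n * shiftZ n 1) * (fourierF n)ᴴ := by
        rw [← Matrix.mul_assoc, fourierF_conjTranspose_mul hn, Matrix.one_mul]
    _ = (fourierF n)ᴴ * diagonal (nodeT n) := by
        rw [fourierF_mul_shiftZ hn, Matrix.mul_assoc, Matrix.mul_assoc,
          fourierF_mul_conjTranspose hn, Matrix.mul_one]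

/-- Scaling by `D` changes the ratio of row `k` to `s_k`, and `s_k^n = -1` matches the corner entry
`-1`. -/
theorem fourierF_mul_diagD_mul_shiftZ {n : ℕ} (hn : n ≠ 0) :
    fourierF n * diagD n * shiftZ n (-1) = diagonal (nodeS n) * (fourierF n * diagD n) := by
  have e (k j : Fin n) : (fourierF n * diagD n) k j = ((1 / Real.sqrt n : ℝ) : ℂ) *
      Complex.exp (Real.pi * Complex.I / n) ^ ((2 * (k : ℕ) + 1) * j) := by
    rw [diagD, mul_diagonal, fourierF, of_apply, root_eq_exp_half_pow, diagEntry_eq_pow, mul_assoc,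
      ← pow_add]
    ring_nf
  ext k j
  rw [mul_shiftZ_apply, diagonal_mul]
  simp only [e]
  rw [nodeS_eq_pow, mul_left_comm, ← pow_add, ← mul_one_add, add_comm 1]
  split_ifs with h
  · rfl
  · have hj : (j : ℕ) + 1 = n := by have := j.isLt; omega
    rw [hj, mul_comm (2 * (k : ℕ) + 1) n, pow_mul _ n, exp_half_pow hn, Odd.neg_one_pow ⟨k, rfl⟩]
    simp

/-- Away from the first row and last column both shifts yield `a (i - j - 1)` and cancel; the four
cases separate this border and its corner. -/
theorem toeplitz_displacement (n : ℕ) (a : ℤ → ℂ) :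
    shiftZ n 1 * toeplitz n a - toeplitz n a * shiftZ n (-1) =
      toeplitzOmega n a * toeplitzGamma n a := by
  ext i j
  have hi := i.isLt
  have hj := j.isLt
  rw [Matrix.sub_apply, shiftZ_mul_apply, mul_shiftZ_apply, mul_apply, Fin.sum_univ_two]
  simp only [toeplitz, toeplitzOmega, toeplitzGamma, of_apply, cons_val_zero, cons_val_one]
  have c : ((n - 1 : ℕ) : ℤ) = n - 1 := by omega
  by_cases h0 : (i : ℕ) = 0 <;> by_cases h1 : (j : ℕ) + 1 = n
  · have h2 : ¬ (j : ℕ) + 1 < n := by omega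
    have h3 : ((n - 1 : ℕ) : ℤ) - (j : ℤ) = 0 := by omega
    simp [h0, h1, h3]
  · have h2 : (j : ℕ) + 1 < n := by omega
    simp only [h0, h1, h2, if_true, if_false, dif_pos, c]
    simp
  · have h2 : ¬ (j : ℕ) + 1 < n := by omega
    have h3 : ((i - 1 : ℕ) : ℤ) - (j : ℤ) = i - n := by omega
    simp [h0, h1, h3]
  · have h2 : (j : ℕ) + 1 < n := by omega
    have h3 : ((i - 1 : ℕ) : ℤ) - (j : ℤ) = i - ((j + 1 : ℕ) : ℤ) := by omega
    simp only [h0, h1, h2, if_false, dif_pos, h3]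
    simp

theorem cauchyType_displacement {n : ℕ} (hn : n ≠ 0) {α : ℕ} (Φ : Matrix (Fin n) (Fin α) ℂ)
    (Ψ : Matrix (Fin α) (Fin n) ℂ) :
    diagonal (nodeT n) * cauchyType (nodeT n) (nodeS n) Φ Ψ -
      cauchyType (nodeT n) (nodeS n) Φ Ψ * diagonal (nodeS n) = Φ * Ψ := by
  ext i j
  have hne := sub_ne_zero.2 (nodeT_ne_nodeS hn i j)
  rw [Matrix.sub_apply, diagonal_mul, mul_diagonal, cauchyType, of_apply]
  field_simp

/-- A Toeplitz matrix is unitarily equivalent to the Cauchy-type matrix with the transformed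
generators. -/
theorem fourierF_mul_toeplitz_mul {n : ℕ} (hn : n ≠ 0) (a : ℤ → ℂ) :
    fourierF n * toeplitz n a * (fourierF n * diagD n)ᴴ =
      cauchyType (nodeT n) (nodeS n) (fourierF n * toeplitzOmega n a)
        (toeplitzGamma n a * (fourierF n * diagD n)ᴴ) := by
  set W := fourierF n * diagD n with hW
  have hWW : W * Wᴴ = 1 := fourierF_mul_diagD_mul_conjTranspose hn
  have hZ : shiftZ n (-1) * Wᴴ = Wᴴ * diagonal (nodeS n) := by
    calc shiftZ n (-1) * Wᴴ = Wᴴ * (W * shiftZ n (-1)) * Wᴴ := by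
          rw [← Matrix.mul_assoc, mul_eq_one_comm.1 hWW, Matrix.one_mul]
      _ = Wᴴ * diagonal (nodeS n) := by
          rw [hW, fourierF_mul_diagD_mul_shiftZ hn, ← hW, Matrix.mul_assoc, Matrix.mul_assoc, hWW,
            Matrix.mul_one]
  have key : diagonal (nodeT n) * (fourierF n * toeplitz n a * Wᴴ) -
      fourierF n * toeplitz n a * Wᴴ * diagonal (nodeS n) =
      fourierF n * toeplitzOmega n a * (toeplitzGamma n a * Wᴴ) := by
    calc _ = fourierF n * (shiftZ n 1 * toeplitz n a - toeplitz n a * shiftZ n (-1)) * Wᴴ := by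
          rw [Matrix.mul_sub, Matrix.sub_mul, ← Matrix.mul_assoc (fourierF n) (shiftZ n 1),
            fourierF_mul_shiftZ hn]
          simp only [Matrix.mul_assoc, hZ]
      _ = _ := by rw [toeplitz_displacement]; simp only [Matrix.mul_assoc]
  -- As `t_i ≠ s_j`, the displacement equation determines each entry by division.
  ext i j
  have hne := sub_ne_zero.2 (nodeT_ne_nodeS hn i j)
  rw [cauchyType, of_apply, ← key, Matrix.sub_apply, diagonal_mul, mul_diagonal]
  field_simp

theorem isToeplitzType_sub_toeplitz {n : ℕ} (hn : n ≠ 0) (a : ℤ → ℂ)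
    (Φ : Matrix (Fin n) (Fin 2) ℂ) (Ψ : Matrix (Fin 2) (Fin n) ℂ) :
    IsToeplitzType 4 ((fourierF n)ᴴ * cauchyType (nodeT n) (nodeS n) Φ Ψ *
      (fourierF n * diagD n) - toeplitz n a) := by
  have hWZ := fourierF_mul_diagD_mul_shiftZ hn
  set W := fourierF n * diagD n
  set R := cauchyType (nodeT n) (nodeS n) Φ Ψ with hR
  -- The two generators of length 2 are placed side by side, the minus sign going to the left
  -- factor.
  let e : Fin 4 ≃ Fin 2 ⊕ Fin 2 := (finSumFinEquiv (m := 2) (n := 2)).symm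
  refine ⟨(fromCols ((fourierF n)ᴴ * Φ) (-toeplitzOmega n a)).submatrix id e,
    (fromRows (Ψ * W) (toeplitzGamma n a)).submatrix e id, ?_⟩
  rw [submatrix_mul_equiv, submatrix_id_id, fromCols_mul_fromRows, Matrix.neg_mul,
    ← toeplitz_displacement]
  have h : shiftZ n 1 * ((fourierF n)ᴴ * R * W) - (fourierF n)ᴴ * R * W * shiftZ n (-1) =
      (fourierF n)ᴴ * Φ * (Ψ * W) := by
    calc _ = (fourierF n)ᴴ * (diagonal (nodeT n) * R - R * diagonal (nodeS n)) * W := by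
          rw [Matrix.mul_sub, Matrix.sub_mul, Matrix.mul_assoc _ W, hWZ, Matrix.mul_assoc _ R W,
            ← Matrix.mul_assoc (shiftZ n 1), shiftZ_mul_conjTranspose_fourierF hn]
          simp only [Matrix.mul_assoc]
      _ = _ := by rw [hR, cauchyType_displacement hn]; simp only [Matrix.mul_assoc]
  rw [← h, Matrix.mul_sub, Matrix.sub_mul]
  abel

/-! ### Rounding errors of the generators -/

theorem norm_sum_mul_sub_le {n : ℕ} {u : ℝ} {f x z : Fin n → ℂ}
    (hf : ∀ j, ‖f j‖ = 1 / Real.sqrt n) (hz : ∀ j, ‖z j - 1‖ ≤ u) :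
    ‖∑ j, f j * x j * z j - ∑ j, f j * x j‖ ≤ u * ((∑ j, ‖x j‖) / Real.sqrt n) := by
  rw [← Finset.sum_sub_distrib, div_eq_mul_one_div, Finset.sum_mul, Finset.mul_sum]
  refine norm_sum_le_of_le _ fun j _ => ?_
  rw [show f j * x j * z j - f j * x j = (z j - 1) * (x j * f j) by ring, norm_mul, norm_mul, hf]
  exact mul_le_mul_of_nonneg_right (hz j) (by positivity)

theorem norm_sum_mul_le {n : ℕ} {f x : Fin n → ℂ} (hf : ∀ j, ‖f j‖ = 1 / Real.sqrt n) :
    ‖∑ j, f j * x j‖ ≤ (∑ j, ‖x j‖) / Real.sqrt n := by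
  rw [div_eq_mul_one_div, Finset.sum_mul]
  refine norm_sum_le_of_le _ fun j _ => ?_
  rw [norm_mul, hf, mul_comm]

theorem norm_fourierF_mul_diagD (n : ℕ) (k j : Fin n) :
    ‖(fourierF n * diagD n) k j‖ = 1 / Real.sqrt n := by
  rw [diagD, mul_diagonal, norm_mul, norm_diagEntry, norm_fourierF, mul_one]

theorem FlPhi.norm_sub_le {ε : ℝ} (hε : 0 ≤ ε) {n : ℕ} {a : ℤ → ℂ}
    {Φ : Matrix (Fin n) (Fin 2) ℂ} (h : FlPhi ε n a Φ) (i : Fin n) (l : Fin 2) :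
    ‖Φ i l - (fourierF n * toeplitzOmega n a) i l‖ ≤
      ((1 + ε) ^ (9 * n) - 1) * ((∑ j, ‖toeplitzOmega n a j l‖) / Real.sqrt n) := by
  obtain ⟨Ω, hΩ, hF⟩ := h
  obtain ⟨Z, hZ, hy⟩ := (hF l).exists_nearOne hε
  choose w hw hw' using fun j => (hΩ j l).exists_nearOne
  have hΦ : Φ i l = ∑ j, fourierF n i j * toeplitzOmega n a j l * (w j * Z i j) := by
    rw [hy i]
    refine Finset.sum_congr rfl fun j _ => ?_
    rw [hw']; ring
  rw [hΦ, mul_apply]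
  refine norm_sum_mul_sub_le (norm_fourierF n i) fun j => ?_
  have := i.isLt
  exact ((hw j).mul (hZ i j)).mono hε (by omega)

theorem FlPsi.norm_sub_le {ε : ℝ} (hε : 0 ≤ ε) {n : ℕ} {a : ℤ → ℂ}
    {Ψ : Matrix (Fin 2) (Fin n) ℂ} (h : FlPsi ε n a Ψ) (l : Fin 2) (k : Fin n) :
    ‖Ψ l k - (toeplitzGamma n a * (fourierF n * diagD n)ᴴ) l k‖ ≤
      ((1 + ε) ^ (9 * n) - 1) * ((∑ j, ‖toeplitzGamma n a l j‖) / Real.sqrt n) := by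
  obtain ⟨Γ, X, d, hΓ, hd, hX, hF⟩ := h
  obtain ⟨Z, hZ, hy⟩ := (hF l).exists_nearOne hε
  choose w hw hw' using fun j => (hΓ l j).exists_nearOne
  choose v hv hv' using fun j => (hd j).exists_nearOne
  choose z hz hz' using fun j => (hX l j).exists_nearOne
  have hΨ : star (Ψ l k) = ∑ j, (fourierF n * diagD n) k j * star (toeplitzGamma n a l j) *
      (v j * star (w j) * z j * Z k j) := by
    rw [hy k]
    refine Finset.sum_congr rfl fun j _ => ?_
    rw [hz', hv', hw', diagD, mul_diagonal, star_mul']; ring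
  have hΨ' : star ((toeplitzGamma n a * (fourierF n * diagD n)ᴴ) l k) =
      ∑ j, (fourierF n * diagD n) k j * star (toeplitzGamma n a l j) := by
    rw [← conjTranspose_apply, conjTranspose_mul, conjTranspose_conjTranspose, mul_apply]
    rfl
  rw [← norm_star, star_sub, hΨ, hΨ']
  simp only [← norm_star (toeplitzGamma n a l _)]
  refine norm_sum_mul_sub_le (norm_fourierF_mul_diagD n k) fun j => ?_
  -- Three roundings precede the transform (`Γ`, `D` and their product): `4n + 3 ≤ 9n`, as `n ≥ 1`.
  have := k.isLt
  exact ((((hv j).mul (hw j).star).mul (hz j)).mul (hZ k j)).mono hε (by omega)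

theorem norm_fourierF_mul_toeplitzOmega_le (n : ℕ) (a : ℤ → ℂ) (i : Fin n) (l : Fin 2) :
    ‖(fourierF n * toeplitzOmega n a) i l‖ ≤ (∑ j, ‖toeplitzOmega n a j l‖) / Real.sqrt n := by
  rw [mul_apply]
  exact norm_sum_mul_le (norm_fourierF n i)

theorem norm_toeplitzGamma_mul_le (n : ℕ) (a : ℤ → ℂ) (l : Fin 2) (k : Fin n) :
    ‖(toeplitzGamma n a * (fourierF n * diagD n)ᴴ) l k‖ ≤
      (∑ j, ‖toeplitzGamma n a l j‖) / Real.sqrt n := by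
  rw [← norm_star, ← conjTranspose_apply, conjTranspose_mul, conjTranspose_conjTranspose, mul_apply]
  simp only [← norm_star (toeplitzGamma n a l _)]
  exact norm_sum_mul_le (norm_fourierF_mul_diagD n k)

/-! ### Norms of the Toeplitz generators -/

/-- The sum of the absolute values in the first row and the first column of `[a_{i-j}]`. -/
noncomputable def borderSum (n : ℕ) [NeZero n] (a : ℤ → ℂ) : ℝ :=
  ∑ j, ‖toeplitz n a 0 j‖ + ∑ i, ‖toeplitz n a i 0‖

theorem borderSum_nonneg (n : ℕ) [NeZero n] (a : ℤ → ℂ) : 0 ≤ borderSum n a := by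
  unfold borderSum; positivity

theorem sum_norm_le_sqrt_mul_vecNorm {n : ℕ} (v : Fin n → ℂ) :
    ∑ i, ‖v i‖ ≤ Real.sqrt n * vecNorm v := by
  rw [vecNorm, EuclideanSpace.norm_eq, ← Real.sqrt_mul (Nat.cast_nonneg n)]
  refine Real.le_sqrt_of_sq_le ?_
  simpa using sq_sum_le_card_mul_sum_sq (s := Finset.univ) (f := fun i => ‖v i‖)

theorem borderSum_le (n : ℕ) [NeZero n] (a : ℤ → ℂ) : borderSum n a ≤ Real.sqrt n *
    (vecNorm (fun j => toeplitz n a 0 j) + vecNorm (fun i => toeplitz n a i 0)) := by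
  rw [borderSum, mul_add]
  exact add_le_add (sum_norm_le_sqrt_mul_vecNorm _) (sum_norm_le_sqrt_mul_vecNorm _)

theorem sum_norm_toeplitzOmega_zero (n : ℕ) [NeZero n] (a : ℤ → ℂ) :
    ∑ i, ‖toeplitzOmega n a i 0‖ = 1 := by
  rw [Finset.sum_eq_single 0]
  · simp [toeplitzOmega]
  · intro i _ hi
    simp [toeplitzOmega, hi]
  · simp

theorem sum_norm_toeplitzGamma_one (n : ℕ) [NeZero n] (a : ℤ → ℂ) :
    ∑ j, ‖toeplitzGamma n a 1 j‖ = 1 := by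
  have hn := Nat.pos_of_ne_zero (NeZero.ne n)
  rw [Finset.sum_eq_single ⟨n - 1, by omega⟩]
  · have : n - 1 + 1 = n := by omega
    simp [toeplitzGamma, this]
  · intro i _ hi
    have : (i : ℕ) + 1 ≠ n := fun h => hi (Fin.ext (by simp; omega))
    simp [toeplitzGamma, this]
  · simp

/-- Negation modulo `n` matches `a (i - n)` with position `n - i` of the first row and fixes `i =
0`. -/
theorem sum_norm_toeplitzOmega_one_le (n : ℕ) [NeZero n] (a : ℤ → ℂ) :
    ∑ i, ‖toeplitzOmega n a i 1‖ ≤ borderSum n a := by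
  rw [borderSum, ← Equiv.sum_comp (Equiv.neg (Fin n)) (fun j => ‖toeplitz n a 0 j‖), ← Finset.sum_add_distrib]
  refine Finset.sum_le_sum fun i _ => ?_
  simp only [toeplitzOmega, toeplitz, of_apply, cons_val_one, cons_val_fin_one, Equiv.neg_apply,
    Fin.val_zero, Nat.cast_zero, sub_zero, zero_sub]
  split_ifs with h
  · rw [h]
    simp
  · have h1 : ((-i : Fin n) : ℕ) = n - i := by
      rw [Fin.val_neg', Nat.mod_eq_of_lt]
      omega
    have h2 : -((n - i : ℕ) : ℤ) = i - n := by omega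
    rw [h1, h2]
    exact norm_add_le _ _

/-- Entry `j` combines position `n - 1 - j` of the first column with position `j + 1`, taken modulo
`n`, of the first row. -/
theorem sum_norm_toeplitzGamma_zero_le (n : ℕ) [NeZero n] (a : ℤ → ℂ) :
    ∑ j, ‖toeplitzGamma n a 0 j‖ ≤ borderSum n a := by
  rw [borderSum, ← Equiv.sum_comp (Equiv.addRight (1 : Fin n)) (fun j => ‖toeplitz n a 0 j‖),
    ← Equiv.sum_comp Fin.revPerm (fun i => ‖toeplitz n a i 0‖), ← Finset.sum_add_distrib]
  refine Finset.sum_le_sum fun j _ => ?_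
  have hj := j.isLt
  have hrev : ((n - (j + 1) : ℕ) : ℤ) = n - 1 - j := by omega
  simp only [toeplitzGamma, toeplitz, of_apply, cons_val_zero, Equiv.coe_addRight,
    Fin.revPerm_apply, Fin.val_rev, hrev, Fin.val_zero, Nat.cast_zero, sub_zero, zero_sub]
  split_ifs with h
  · have h2 : (n : ℤ) - 1 - (j : ℤ) = 0 := by omega
    rw [h2]
    exact le_add_of_nonneg_left (norm_nonneg _)
  · have h1 : ((j + 1 : Fin n) : ℕ) = j + 1 := by
      rw [Fin.val_add, Fin.val_one', Nat.add_mod_mod, Nat.mod_eq_of_lt]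
      omega
    rw [h1, add_comm ‖_‖ ‖_‖]
    push_cast
    exact norm_sub_le _ _

/-! ### The error of the Cauchy-type matrix -/

theorem norm_mul_sub_mul_le {u A B : ℝ} {x x' y y' : ℂ} (hu : 0 ≤ u)
    (hx : ‖x - x'‖ ≤ u * A) (hy : ‖y - y'‖ ≤ u * B) (hx' : ‖x'‖ ≤ A) (hy' : ‖y'‖ ≤ B) :
    ‖x * y - x' * y'‖ ≤ u * (2 + u) * (A * B) := by
  have hA : 0 ≤ A := (norm_nonneg _).trans hx'
  have h1 : ‖(x - x') * (y - y')‖ ≤ u * A * (u * B) := by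
    rw [norm_mul]
    exact mul_le_mul hx hy (norm_nonneg _) (by positivity)
  have h2 : ‖(x - x') * y'‖ ≤ u * A * B := by
    rw [norm_mul]
    exact mul_le_mul hx hy' (norm_nonneg _) (by positivity)
  have h3 : ‖x' * (y - y')‖ ≤ A * (u * B) := by
    rw [norm_mul]
    exact mul_le_mul hx' hy (norm_nonneg _) hA
  have e : x * y - x' * y' = (x - x') * (y - y') + (x - x') * y' + x' * (y - y') := by ring
  rw [e]
  refine norm_add₃_le.trans ?_
  linarith

theorem norm_mul_sub_generators_le {n : ℕ} [NeZero n] {ε : ℝ} (hε : 0 ≤ ε) {a : ℤ → ℂ}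
    {Φ : Matrix (Fin n) (Fin 2) ℂ} {Ψ : Matrix (Fin 2) (Fin n) ℂ}
    (hΦ : FlPhi ε n a Φ) (hΨ : FlPsi ε n a Ψ) {u : ℝ} (hu : (1 + ε) ^ (9 * n) - 1 ≤ u)
    (i j : Fin n) :
    ‖(Φ * Ψ) i j - (fourierF n * toeplitzOmega n a *
      (toeplitzGamma n a * (fourierF n * diagD n)ᴴ)) i j‖ ≤
      2 * (u * (2 + u)) * (borderSum n a / n) := by
  have hu0 : 0 ≤ u := (sub_nonneg.2 (one_le_pow₀ (by linarith))).trans hu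
  have hS := borderSum_nonneg n a
  have hss : Real.sqrt n * Real.sqrt n = n := Real.mul_self_sqrt (Nat.cast_nonneg n)
  rw [mul_apply, mul_apply, ← Finset.sum_sub_distrib, mul_assoc, two_mul]
  have key (l : Fin 2) : ‖Φ i l * Ψ l j - (fourierF n * toeplitzOmega n a) i l *
      (toeplitzGamma n a * (fourierF n * diagD n)ᴴ) l j‖ ≤
      u * (2 + u) * (borderSum n a / n) := by
    refine (norm_mul_sub_mul_le hu0
      ((hΦ.norm_sub_le hε i l).trans (mul_le_mul_of_nonneg_right hu (by positivity)))
      ((hΨ.norm_sub_le hε l j).trans (mul_le_mul_of_nonneg_right hu (by positivity)))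
      (norm_fourierF_mul_toeplitzOmega_le n a i l)
      (norm_toeplitzGamma_mul_le n a l j)).trans ?_
    refine mul_le_mul_of_nonneg_left ?_ (by positivity)
    rw [div_mul_div_comm, hss]
    refine div_le_div_of_nonneg_right ?_ (Nat.cast_nonneg n)
    -- For `l = 0` the left generator is `e_1`, for `l = 1` the right one is `e_n^T`: the product of
    -- `ℓ¹` norms is linear in `borderSum`.
    fin_cases l
    · have := sum_norm_toeplitzGamma_zero_le n a
      simpa [sum_norm_toeplitzOmega_zero] using this
    · have := sum_norm_toeplitzOmega_one_le n a
      simpa [sum_norm_toeplitzGamma_one] using this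
  rw [Fin.sum_univ_two]
  exact norm_add_le_of_le (key 0) (key 1)

theorem norm_cauchyType_sub_le {n : ℕ} (hn : n ≠ 0) {α β : ℕ} {Φ : Matrix (Fin n) (Fin α) ℂ}
    {Ψ : Matrix (Fin α) (Fin n) ℂ} {Φ' : Matrix (Fin n) (Fin β) ℂ}
    {Ψ' : Matrix (Fin β) (Fin n) ℂ} {b : ℝ} (hb : 0 ≤ b)
    (h : ∀ i j, ‖(Φ * Ψ) i j - (Φ' * Ψ') i j‖ ≤ b) :
    ‖cauchyType (nodeT n) (nodeS n) Φ Ψ - cauchyType (nodeT n) (nodeS n) Φ' Ψ'‖ ≤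
      b * (Real.sqrt n / 2 * n) := by
  rw [← norm_cauchyNodes hn]
  refine frobenius_norm_le_of_entries hb fun i j => ?_
  rw [Matrix.sub_apply, cauchyType, cauchyType, cauchyNodes, of_apply, of_apply, of_apply, ← sub_div,
    div_eq_mul_one_div, norm_mul]
  exact mul_le_mul_of_nonneg_right (h i j) (norm_nonneg _)

theorem one_add_pow_sub_one_le {n : ℕ} {ε : ℝ} (hε : 0 ≤ ε) (hn : n * ε ≤ 1) :
    (1 + ε) ^ (9 * n) - 1 ≤ 9 * Real.exp 9 * (n * ε) := by
  have h1 : (1 + ε) ^ (9 * n) ≤ Real.exp (9 * (n * ε)) := by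
    calc (1 + ε) ^ (9 * n) ≤ Real.exp ε ^ (9 * n) := by
          refine pow_le_pow_left₀ (by linarith) ?_ _
          linarith [Real.add_one_le_exp ε]
      _ = Real.exp (9 * (n * ε)) := by
          rw [← Real.exp_nat_mul]
          push_cast
          ring_nf
  have h2 : Real.exp (9 * (n * ε)) - 1 ≤ 9 * (n * ε) * Real.exp (9 * (n * ε)) := by
    -- Multiplying `1 - x ≤ e^(-x)` by `e^x` gives `e^x - 1 ≤ x e^x`; then `x = 9nε ≤ 9`.
    have h3 := Real.add_one_le_exp (-(9 * (n * ε)))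
    have h4 := mul_le_mul_of_nonneg_right h3 (Real.exp_pos (9 * (n * ε))).le
    rw [← Real.exp_add, neg_add_cancel, Real.exp_zero] at h4
    linarith
  have h5 : 9 * (n * ε) * Real.exp (9 * (n * ε)) ≤ 9 * (n * ε) * Real.exp 9 :=
    mul_le_mul_of_nonneg_left (Real.exp_le_exp.2 (by linarith)) (by positivity)
  linarith

theorem norm_sub_toeplitz_le {n : ℕ} [NeZero n] {ε : ℝ} (hε : 0 ≤ ε) (hnε : n * ε ≤ 1)
    {a : ℤ → ℂ} {Φ : Matrix (Fin n) (Fin 2) ℂ} {Ψ : Matrix (Fin 2) (Fin n) ℂ}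
    (hΦ : FlPhi ε n a Φ) (hΨ : FlPsi ε n a Ψ) :
    ‖(fourierF n)ᴴ * cauchyType (nodeT n) (nodeS n) Φ Ψ * (fourierF n * diagD n) -
      toeplitz n a‖ ≤ ε * (9 * Real.exp 9 * (2 + 9 * Real.exp 9)) * (n : ℝ) ^ 2 *
        (vecNorm (fun j => toeplitz n a 0 j) + vecNorm (fun i => toeplitz n a i 0)) := by
  have hn := NeZero.ne n
  have hF := fourierF_conjTranspose_mul hn
  have hF' := fourierF_mul_conjTranspose hn
  have hW := fourierF_mul_diagD_mul_conjTranspose hn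
  have hT := fourierF_mul_toeplitz_mul hn a
  set W := fourierF n * diagD n
  set R := cauchyType (nodeT n) (nodeS n) Φ Ψ
  set R' := cauchyType (nodeT n) (nodeS n) (fourierF n * toeplitzOmega n a)
    (toeplitzGamma n a * Wᴴ)
  have hsub : (fourierF n)ᴴ * R * W - toeplitz n a = (fourierF n)ᴴ * (R - R') * W := by
    rw [Matrix.mul_sub, Matrix.sub_mul, ← hT]
    congr 1
    calc toeplitz n a = ((fourierF n)ᴴ * fourierF n) * toeplitz n a * (Wᴴ * W) := by
          rw [hF, mul_eq_one_comm.1 hW, Matrix.one_mul, Matrix.mul_one]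
      _ = _ := by simp only [Matrix.mul_assoc]
  rw [hsub, frobenius_norm_mul_unitary hW, frobenius_norm_unitary_mul (by simpa using hF')]
  set κ := 9 * Real.exp 9
  have hκ : 0 ≤ κ := by positivity
  have hu := one_add_pow_sub_one_le hε hnε
  have hu0 : 0 ≤ κ * (n * ε) := by positivity
  have hu1 : κ * (n * ε) ≤ κ := mul_le_of_le_one_right hκ hnε
  have hS := borderSum_nonneg n a
  have hn' : (n : ℝ) ≠ 0 := by exact_mod_cast hn
  have hss : Real.sqrt n * Real.sqrt n = n := Real.mul_self_sqrt (Nat.cast_nonneg n)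
  set S := vecNorm (fun j => toeplitz n a 0 j) + vecNorm (fun i => toeplitz n a i 0)
  calc ‖R - R'‖ ≤ 2 * (κ * (n * ε) * (2 + κ * (n * ε))) * (borderSum n a / n) *
        (Real.sqrt n / 2 * n) :=
        norm_cauchyType_sub_le hn (by positivity) (norm_mul_sub_generators_le hε hΦ hΨ hu)
    _ = κ * (n * ε) * (2 + κ * (n * ε)) * (Real.sqrt n * borderSum n a) := by
        field_simp
    _ ≤ κ * (n * ε) * (2 + κ) * (Real.sqrt n * (Real.sqrt n * S)) := by
        have := borderSum_le n a
        gcongr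
    _ = ε * (κ * (2 + κ)) * (n : ℝ) ^ 2 * S := by
        rw [← mul_assoc (Real.sqrt n), hss]
        ring

end GKO

/-! ### The decomposition of the total error. -/

open Matrix in
theorem mainTheorem3 :
    ∃ c₁₁ : ℝ, 0 < c₁₁ ∧
      ∀ (n : ℕ) [NeZero n] (ε : ℝ), 0 < ε → (n : ℝ) * ε ≤ 1 →
      ∀ (a : ℤ → ℂ) (Φ : Matrix (Fin n) (Fin 2) ℂ) (Ψ : Matrix (Fin 2) (Fin n) ℂ)
        (σ : Equiv.Perm (Fin n)) (L U : Matrix (Fin n) (Fin n) ℂ),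
        GKO.FlGKOToeplitz ε n a Φ Ψ σ L U →
        ∃ E₁ E₂ : Matrix (Fin n) (Fin n) ℂ,
          (GKO.fourierF n).conjTranspose * ((GKO.permP σ).transpose * L * U) *
              GKO.fourierF n * GKO.diagD n = GKO.toeplitz n a + E₁ + E₂ ∧
          ‖E₁‖ = ‖GKO.cauchyBackwardError Φ Ψ σ L U‖ ∧
          GKO.IsToeplitzType 4 E₂ ∧
          ‖E₂‖ ≤ ε * c₁₁ * (n : ℝ) ^ 2 *
            (GKO.vecNorm (fun j => GKO.toeplitz n a 0 j) +
              GKO.vecNorm (fun i => GKO.toeplitz n a i 0)) := by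
  -- With `κ = 9 e^9`, this comes from `u (2 + u)` at `u = κ n ε`, using `n ε ≤ 1` in the second
  -- factor only.
  refine ⟨9 * Real.exp 9 * (2 + 9 * Real.exp 9), by positivity, ?_⟩
  intro n _ ε hε hnε a Φ Ψ σ L U ⟨hΦ, hΨ, _⟩
  have hn := NeZero.ne n
  refine ⟨(GKO.fourierF n)ᴴ * GKO.cauchyBackwardError Φ Ψ σ L U * (GKO.fourierF n * GKO.diagD n),
    (GKO.fourierF n)ᴴ * GKO.cauchyType (GKO.nodeT n) (GKO.nodeS n) Φ Ψ *
      (GKO.fourierF n * GKO.diagD n) - GKO.toeplitz n a, ?_, ?_,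
    GKO.isToeplitzType_sub_toeplitz hn a Φ Ψ, GKO.norm_sub_toeplitz_le hε.le hnε hΦ hΨ⟩
  · rw [GKO.cauchyBackwardError, Matrix.mul_sub, Matrix.sub_mul, ← Matrix.mul_assoc _ _ (GKO.diagD n)]
    abel
  · rw [GKO.frobenius_norm_mul_unitary (GKO.fourierF_mul_diagD_mul_conjTranspose hn),
      GKO.frobenius_norm_unitary_mul (by simpa using GKO.fourierF_mul_conjTranspose hn)]
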